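/- All groups are finite and all representations are finite-dimensional over $\mathbb C$. For a representation $\mathcal R$ of a group $H$ with irreducible representations $\rho_1,\dots,\rho_n$ (up to equivalence), the McKay quiver $\mathcal Q(H,\mathcal R)$ has vertices $1,\dots,n$ and $a_{ij}$ arrows from $i$ to $j$, where $\mathcal R\otimes\rho_i\cong\bigoplus_j a_{ij}\rho_j$. An extension $1\to A\to E\xrightarrow{\pi_E}G\to1$ is central if (the image of) $A$ lies in $Z(E)$, and stem if $A$ lies in $Z(E)\cap[E,E]$. Two extensions $\pi_E:E\to G$ and $\pi_F:F\to G$ of $G$ are isoclinic if there are isomorphisms $\eta:E/Z(E)\to F/Z(F)$ and $\nu:[E,E]\to[F,F]$ that commute with the commutator maps (that is, $\nu([e_1,e_2])=[f_1,f_2]$ whenever $\eta(e_iZ(E))=f_iZ(F)$ for $i=1,2$) and are compatible with the projections to $G$, in the sense that $\eta(eZ(E))=fZ(F)$ whenever $\pi_E(e)=\pi_F(f)$. **Proposition.** Let $1\to A\to E\xrightarrow{\pi_E}G\to1$ be a central extension that is isoclinic, as an extension of $G$, to a stem extension $1\to B\to F\xrightarrow{\pi_F}G\to1$. Let $\mathcal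 R$ be a faithful representation of $G$, with lifts $\mathcal R_E=\mathcal R\circ\pi_E$ and $\mathcal R_F=\mathcal R\circ\pi_F$. Then $|F|$ divides $|E|$, and with $k=|E|/|F|$ there is an isomorphism of quivers $$\mathcal Q(E,\mathcal R_E)\;\cong\;\bigsqcup_{i=1}^{k}\mathcal Q(F,\mathcal R_F).$$ -/

import Mathlib

open scoped TensorProduct commutatorElement

noncomputable section

/-! ### Irreducible complex representations and McKay quivers -/

/-- A finite-dimensional irreducible complex representation of `G`, given by matrices. -/
structure IrrRep (G : Type*) [Group G] where
  dim : ℕ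
  ρ : Representation ℂ G (Fin dim → ℂ)
  irreducible : ρ.IsIrreducible

/-- Equivalence of irreducible representations. -/
instance IrrRep.setoid (G : Type*) [Group G] : Setoid (IrrRep G) where
  r i j := Nonempty (i.ρ.Equiv j.ρ)
  iseqv :=
    { refl := fun i => ⟨Representation.Equiv.refl i.ρ⟩
      symm := fun ⟨e⟩ => ⟨e.symm⟩
      trans := fun ⟨e⟩ ⟨f⟩ => ⟨e.trans f⟩ }

/-- The set of equivalence classes of irreducible complex representations of `G`. -/
def Irr (G : Type*) [Group G] : Type _ := Quotient (IrrRep.setoid G)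

/-- A chosen representative `ρ_i` of the class `i`. -/
def Irr.rep {G : Type*} [Group G] (i : Irr G) : Representation ℂ G (Fin (Quotient.out i).dim → ℂ) :=
  (Quotient.out i).ρ

/-- The multiplicity of the irreducible representation `ρ_j` in `σ`, as the dimension of the space
of intertwining maps `ρ_j → σ`. It is the number of copies of `ρ_j` in a decomposition of `σ` into
irreducible representations: this is `equiv_irrSum_iff` below. -/
def irrMultiplicity {G : Type*} [Group G] {W : Type*} [AddCommGroup W] [Module ℂ W]
    (σ : Representation ℂ G W) (j : Irr G) : ℕ :=
  Module.finrank ℂ (Representation.IntertwiningMap j.rep σ)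

instance Irr.rep_irreducible {G : Type*} [Group G] (i : Irr G) : i.rep.IsIrreducible :=
  (Quotient.out i).irreducible

theorem Irr.eq_of_equiv {G : Type*} [Group G] {i j : Irr G} (e : i.rep.Equiv j.rep) : i = j := by
  have h : (Quotient.out i) ≈ (Quotient.out j) := ⟨e⟩
  rw [← Quotient.out_eq i, ← Quotient.out_eq j]
  exact Quotient.sound h

/-- The direct sum `⨁_j a_j ρ_j`. -/
abbrev irrSum {G : Type*} [Group G] (a : Irr G → ℕ) :=
  Representation.directSum (fun p : Σ j : Irr G, Fin (a j) => p.1.rep)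

open Representation in
theorem IsIrreducible.of_equiv {G V W : Type*} [Group G] [AddCommGroup V] [Module ℂ V]
    [AddCommGroup W] [Module ℂ W] {ρ : Representation ℂ G V} {σ : Representation ℂ G W}
    (e : ρ.Equiv σ) (h : ρ.IsIrreducible) : σ.IsIrreducible := by
  rw [irreducible_iff_isSimpleModule_asModule] at h ⊢
  let f := IntertwiningMap.equivLinearMapAsModule _ _ e.symm.toIntertwiningMap
  exact IsSimpleModule.congr (LinearEquiv.ofBijective f e.symm.toLinearEquiv.bijective)

open Representation in
theorem Irr.exists_equiv {G V : Type*} [Group G] [AddCommGroup V] [Module ℂ V]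
    [FiniteDimensional ℂ V] (τ : Representation ℂ G V) (h : τ.IsIrreducible) :
    ∃ c : Irr G, Nonempty (τ.Equiv c.rep) := by
  let e : V ≃ₗ[ℂ] (Fin (Module.finrank ℂ V) → ℂ) := (Module.finBasis ℂ V).equivFun
  let ρ : Representation ℂ G (Fin (Module.finrank ℂ V) → ℂ) :=
    { toFun := fun g => e.conj (τ g)
      map_one' := by ext; simp [LinearEquiv.conj_apply]
      map_mul' := fun g h => by rw [map_mul]; exact LinearEquiv.conj_comp e _ _ }
  let E : τ.Equiv ρ := Representation.Equiv.mk e (fun g => by ext v; simp [ρ, LinearEquiv.conj_apply])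
  let I : IrrRep G := ⟨_, ρ, IsIrreducible.of_equiv E h⟩
  obtain ⟨E'⟩ : (Quotient.out (Quotient.mk (IrrRep.setoid G) I)) ≈ I := Quotient.mk_out I
  exact ⟨Quotient.mk _ I, ⟨E.trans E'.symm⟩⟩

open Representation in
theorem exists_equiv_irrSum {G W : Type*} [Group G] [Finite G] [AddCommGroup W] [Module ℂ W]
    [FiniteDimensional ℂ W] (σ : Representation ℂ G W) :
    ∃ a : Irr G → ℕ, Nonempty (σ.Equiv (irrSum a)) := by
  classical
  have : FiniteDimensional ℂ σ.asModule := ‹FiniteDimensional ℂ W›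
  have : Module.Finite (MonoidAlgebra ℂ G) σ.asModule :=
    Module.Finite.of_restrictScalars_finite ℂ _ _
  obtain ⟨n, S, e, hS⟩ :=
    IsSemisimpleModule.exists_linearEquiv_fin_dfinsupp (MonoidAlgebra ℂ G) σ.asModule
  let T : Fin n → Subrepresentation σ := fun i => Subrepresentation.ofSubmodule' (S i)
  have hT : ∀ i, (T i).toRepresentation.IsIrreducible := by
    intro i
    rw [irreducible_iff_isSimpleModule_asModule]
    have := hS i
    have key : ∀ (m : MonoidAlgebra ℂ G) (x : S i) (y : (T i).toRepresentation.asModule),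
        (x : σ.asModule) = (y : (T i).toSubmodule).1 →
        ((m • x : S i) : σ.asModule) = ((m • y : (T i).toRepresentation.asModule) : (T i).toSubmodule).1 := by
      intro m x y hxy
      induction m using MonoidAlgebra.induction_linear with
      | zero => rw [zero_smul, zero_smul]; rfl
      | add a b ha hb =>
        rw [add_smul, add_smul]
        exact congrArg₂ (· + ·) ha hb
      | single g r =>
        rw [Representation.single_smul]
        refine (Representation.single_smul σ r g (x : σ.asModule)).trans ?_
        exact congrArg (fun z : W => r • σ g z) hxy
    let f : S i ≃ₗ[MonoidAlgebra ℂ G] (T i).toRepresentation.asModule :=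
      { toFun := fun x => (⟨x.1, x.2⟩ : (T i).toSubmodule)
        invFun := fun x => ⟨(x : (T i).toSubmodule).1, (x : (T i).toSubmodule).2⟩
        left_inv := fun _ => rfl
        right_inv := fun _ => rfl
        map_add' := fun _ _ => rfl
        map_smul' := fun m x => Subtype.ext (key m x _ rfl) }
    exact IsSimpleModule.congr f.symm
  choose c hc using fun i => Irr.exists_equiv (T i).toRepresentation (hT i)
  have u : ∀ i, (T i).toRepresentation.Equiv (c i).rep := fun i => (hc i).some
  let a : Irr G → ℕ := fun j => Fintype.card {i // c i = j}
  let κ : (Σ j, Fin (a j)) ≃ Fin n :=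
    (Equiv.sigmaCongrRight fun j => (Fintype.equivFin {i // c i = j}).symm).trans
      (Equiv.sigmaFiberEquiv c)
  have hκ : ∀ p, c (κ p) = p.1 := fun p => by
    exact ((Fintype.equivFin {i // c i = p.1}).symm p.2).2
  have v : ∀ p : Σ j, Fin (a j), (T (κ p)).toRepresentation.Equiv p.1.rep := fun p =>
    hκ p ▸ u (κ p)
  let L : W ≃ₗ[ℂ] DirectSum (Σ j, Fin (a j)) (fun p => Fin (Quotient.out p.1).dim → ℂ) :=
    (e.restrictScalars ℂ : W ≃ₗ[ℂ] DirectSum (Fin n) (fun i => S i)) ≪≫ₗ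
      (DirectSum.lequivCongrLeft ℂ κ.symm ≪≫ₗ
        DirectSum.congrLinearEquiv (fun p => (v p).toLinearEquiv))
  have hL : ∀ w p, L w p = v p (e w (κ p)) := fun w p => rfl
  refine ⟨a, ⟨Representation.Equiv.mk L fun g => ?_⟩⟩
  ext w p : 2
  have h1 : e (σ g w) = MonoidAlgebra.single g (1 : ℂ) • e w := by
    refine Eq.trans ?_ (e.map_smul (MonoidAlgebra.single g (1 : ℂ)) w)
    exact congrArg e (((one_smul ℂ _).symm).trans
      (Representation.single_smul σ 1 g (w : σ.asModule)).symm)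
  have h2 : e (σ g w) (κ p) = (T (κ p)).toRepresentation g (e w (κ p)) := by
    rw [h1]
    refine Subtype.ext ((Representation.single_smul σ 1 g
      ((e w (κ p) : S (κ p)) : σ.asModule)).trans (one_smul ℂ _))
  calc L (σ g w) p = v p (e (σ g w) (κ p)) := rfl
    _ = v p ((T (κ p)).toRepresentation g (e w (κ p))) := by rw [h2]
    _ = p.1.rep g (v p (e w (κ p))) :=
      IntertwiningMap.isIntertwining _ _ (v p).toIntertwiningMap g (e w (κ p))
    _ = (irrSum a g (L w)) p := rfl

open Representation in
theorem finrank_irrSum {G : Type*} [Group G] (a : Irr G → ℕ) (j : Irr G) :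
    Module.finrank ℂ (IntertwiningMap j.rep (irrSum a)) = a j := by
  classical
  let ι : Fin (a j) → IntertwiningMap j.rep (irrSum a) := fun t =>
    { toLinearMap := DirectSum.lof ℂ (Σ j : Irr G, Fin (a j))
        (fun p => Fin (Quotient.out p.1).dim → ℂ) ⟨j, t⟩
      isIntertwining' := fun g => by
        refine LinearMap.ext fun v => ?_
        exact (DirectSum.lmap_lof (fun p : Σ j : Irr G, Fin (a j) => p.1.rep g)
          (⟨j, t⟩ : Σ j : Irr G, Fin (a j)) v).symm }
  let Φ : (Fin (a j) → ℂ) →ₗ[ℂ] IntertwiningMap j.rep (irrSum a) :=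
    Fintype.linearCombination ℂ ι
  let ev : ∀ (_ : Fin (Quotient.out j).dim → ℂ) (p : Σ j : Irr G, Fin (a j)),
      IntertwiningMap j.rep (irrSum a) →ₗ[ℂ] (Fin (Quotient.out p.1).dim → ℂ) := fun v p =>
    { toFun := fun f => (f v) p
      map_add' := fun _ _ => rfl
      map_smul' := fun _ _ => rfl }
  have hΦ : ∀ c v p, (Φ c v) p = ∑ t, c t • (DirectSum.lof ℂ (Σ j : Irr G, Fin (a j))
            (fun p => Fin (Quotient.out p.1).dim → ℂ) ⟨j, t⟩ v) p := by
    intro c v p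
    change ev v p (Φ c) = _
    rw [Fintype.linearCombination_apply, map_sum]
    rfl
  have hΦ1 : ∀ c v t, (Φ c v) ⟨j, t⟩ = c t • v := by
    intro c v t
    rw [hΦ, Finset.sum_eq_single t]
    · rw [DirectSum.lof_apply]
    · intro s _ hs
      rw [DirectSum.lof_eq_of, DirectSum.of_eq_of_ne, smul_zero]
      simpa using hs.symm
    · simp
  have hΦ0 : ∀ c v p, p.1 ≠ j → (Φ c v) p = 0 := by
    intro c v p hp
    rw [hΦ]
    refine Finset.sum_eq_zero fun s _ => ?_
    rw [DirectSum.lof_eq_of, DirectSum.of_eq_of_ne, smul_zero]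
    rintro rfl
    exact hp rfl
  have hnt : ∃ v : Fin (Quotient.out j).dim → ℂ, v ≠ 0 := by
    have : Nontrivial j.rep.asModule :=
      have := (irreducible_iff_isSimpleModule_asModule j.rep).1 inferInstance
      IsSimpleModule.nontrivial (MonoidAlgebra ℂ G) _
    exact exists_ne (0 : j.rep.asModule)
  have hinj : Function.Injective Φ := by
    intro c d h
    obtain ⟨v, hv⟩ := hnt
    funext t
    have := hΦ1 c v t
    rw [h, hΦ1] at this
    exact (smul_left_injective ℂ hv this).symm
  have hsurj : Function.Surjective Φ := by
    intro f
    let π : ∀ p : Σ j : Irr G, Fin (a j), IntertwiningMap j.rep p.1.rep := fun p =>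
      { toLinearMap := DirectSum.component ℂ _ _ p ∘ₗ f.toLinearMap
        isIntertwining' := fun g => by
          refine LinearMap.ext fun v => ?_
          exact congrArg (fun z => z p) (IntertwiningMap.isIntertwining _ _ f g v) }
    have hs : ∀ t : Fin (a j), ∃ c : ℂ, algebraMap ℂ (IntertwiningMap j.rep j.rep) c = π ⟨j, t⟩ :=
      fun t => IsIrreducible.algebraMap_intertwiningMap_bijective_of_isAlgClosed.2 _
    choose c hc using hs
    refine ⟨c, IntertwiningMap.toLinearMap_injective _ _ (LinearMap.ext fun v => ?_)⟩
    refine DFinsupp.ext fun p => ?_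
    change (Φ c v) p = π p v
    by_cases hp : p.1 = j
    · obtain ⟨j', t⟩ := p
      subst hp
      rw [hΦ1, ← hc]
      rfl
    · rw [hΦ0 _ _ _ hp]
      rcases IsIrreducible.bijective_or_eq_zero (π p) with h | h
      · exact absurd (Irr.eq_of_equiv (IntertwiningMap.ofBijective (π p) h)).symm hp
      · rw [h]; rfl
  rw [← (LinearEquiv.ofBijective Φ ⟨hinj, hsurj⟩).finrank_eq]
  simp

open Representation in
/-- `σ ≅ ⨁_j a_j ρ_j` if and only if every `a_j` is the multiplicity of `ρ_j` in `σ`. -/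
theorem equiv_irrSum_iff {G W : Type*} [Group G] [Finite G] [AddCommGroup W] [Module ℂ W]
    [FiniteDimensional ℂ W] (σ : Representation ℂ G W) (a : Irr G → ℕ) :
    Nonempty (σ.Equiv (irrSum a)) ↔ a = irrMultiplicity σ := by
  have key : ∀ b : Irr G → ℕ, Nonempty (σ.Equiv (irrSum b)) → b = irrMultiplicity σ := by
    rintro b ⟨e⟩
    funext j
    rw [← finrank_irrSum b j, irrMultiplicity]
    let f : IntertwiningMap j.rep (irrSum b) ≃ₗ[ℂ] IntertwiningMap j.rep σ :=
      LinearEquiv.ofLinearMap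
        (IntertwiningMap.llcomp _ _ _ e.symm.toIntertwiningMap)
        (IntertwiningMap.llcomp _ _ _ e.toIntertwiningMap)
        (LinearMap.ext fun x => IntertwiningMap.toLinearMap_injective _ _
          (LinearMap.ext fun v => e.toLinearEquiv.symm_apply_apply (x v)))
        (LinearMap.ext fun x => IntertwiningMap.toLinearMap_injective _ _
          (LinearMap.ext fun v => e.toLinearEquiv.apply_symm_apply (x v)))
    exact f.finrank_eq
  refine ⟨key a, ?_⟩
  rintro rfl
  obtain ⟨b, hb⟩ := exists_equiv_irrSum σ
  rwa [← key b hb]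

/-- The adjacency matrix `a_ij` of the McKay quiver of `G` relative to `R`: the multiplicity of `ρ_j`
in `R ⊗ ρ_i`. -/
def mckayMatrix {G V : Type*} [Group G] [AddCommGroup V] [Module ℂ V]
    (R : Representation ℂ G V) (i j : Irr G) : ℕ :=
  irrMultiplicity (R.tprod i.rep) j

/-- `R ⊗ ρ_i ≅ ⨁_j a_ij ρ_j`, and this determines the row `a_i`. -/
theorem mckayMatrix_spec {G V : Type*} [Group G] [Finite G] [AddCommGroup V] [Module ℂ V]
    [FiniteDimensional ℂ V] (R : Representation ℂ G V) (i : Irr G) (a : Irr G → ℕ) :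
    Nonempty ((R.tprod i.rep).Equiv (irrSum a)) ↔ a = mckayMatrix R i :=
  equiv_irrSum_iff (R.tprod i.rep) a

/-- The vertices of the McKay quiver of `G` relative to `R`. -/
def McKayQuiver {G V : Type*} [Group G] [AddCommGroup V] [Module ℂ V]
    (_R : Representation ℂ G V) : Type _ := Irr G

/-- There are `a_ij` arrows from `i` to `j`. -/
instance McKayQuiver.quiver {G V : Type*} [Group G] [AddCommGroup V] [Module ℂ V]
    (R : Representation ℂ G V) : Quiver (McKayQuiver R) where
  Hom i j := Fin (mckayMatrix R i j)

/-- An isomorphism of quivers: a bijection on vertices, with bijections on arrows. -/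
structure QuiverIso (Q Q' : Type*) [Quiver Q] [Quiver Q'] where
  vertex : Q ≃ Q'
  arrow : ∀ x y : Q, (x ⟶ y) ≃ (vertex x ⟶ vertex y)

/-- The vertices of the disjoint union of `k` copies of the quiver `Q`. -/
def QuiverCopies (k : ℕ) (Q : Type*) : Type _ := Fin k × Q

/-- Arrows only join vertices of the same copy, where they are the arrows of `Q`. -/
instance QuiverCopies.quiver (k : ℕ) (Q : Type*) [Quiver Q] : Quiver (QuiverCopies k Q) where
  Hom x y := {_f : x.2 ⟶ y.2 // x.1 = y.1}

/-! ### Central and stem extensions, isoclinism -/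

/-- The extension `1 → A → E → G → 1` is central. -/
def IsCentralExtension {A E G : Type*} [Group A] [Group E] [Group G]
    (S : GroupExtension A E G) : Prop :=
  S.inl.range ≤ Subgroup.center E

/-- The extension `1 → A → E → G → 1` is a stem extension. -/
def IsStemExtension {A E G : Type*} [Group A] [Group E] [Group G]
    (S : GroupExtension A E G) : Prop :=
  S.inl.range ≤ Subgroup.center E ⊓ commutator E

/-- An isoclinism of groups: isomorphisms `η` of the central quotients and `ν` of the derived
subgroups, commuting with the commutator maps. -/
structure Isoclinism (E F : Type*) [Group E] [Group F] where
  η : E ⧸ Subgroup.center E ≃* F ⧸ Subgroup.center F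
  ν : commutator E ≃* commutator F
  comm : ∀ (e₁ e₂ : E) (f₁ f₂ : F), η (e₁ : E ⧸ Subgroup.center E) = (f₁ : F ⧸ Subgroup.center F) →
    η (e₂ : E ⧸ Subgroup.center E) = (f₂ : F ⧸ Subgroup.center F) →
    (ν ⟨⁅e₁, e₂⁆, Subgroup.commutator_mem_commutator (Subgroup.mem_top e₁) (Subgroup.mem_top e₂)⟩ : F)
      = ⁅f₁, f₂⁆

/-- Two extensions `S`, `T` of the same group `G` are isoclinic as extensions of `G` if their middle
groups have an isoclinism for which `η` is induced by the identity of `G`: elements over the same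
element of `G` have corresponding classes modulo the centers. -/
def IsoclinicExtensions {A E B F G : Type*} [Group A] [Group E] [Group B] [Group F] [Group G]
    (S : GroupExtension A E G) (T : GroupExtension B F G) : Prop :=
  ∃ I : Isoclinism E F, ∀ (e : E) (f : F), S.rightHom e = T.rightHom f →
    I.η (e : E ⧸ Subgroup.center E) = (f : F ⧸ Subgroup.center F)

end

noncomputable section

/-! ### Extension of linear characters -/

/-! Irreducible representations of E are sorted by the character χ through which A acts. The lift of
R is trivial on A, so tensoring with it preserves χ, and the McKay quiver splits into blocks indexed
by χ. The same holds for F and the characters of B.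

Blocks are compared on P = E ×_G F, whose projections to E and F have kernels B and A. By the
isoclinism, [P, P] lies in the graph of ν (`Isoclinism.exists_coe_eq_fst`). As B lies in [F, F], ν⁻¹
restricts to an embedding j : B → A, and elements of A × B lying in [P, P] have the form (j b, b).
Hence (a, b) ↦ χ(a)⁻¹ χ(j b) is trivial there and extends to a linear character μ of P
(`exists_comparisonCharacter`). If A acts on ρ by χ, the inflation of ρ to P twisted by μ is trivial
on A, so it descends to F, where B acts by χ ∘ j; twisting by μ⁻¹ goes back. Both lifts of R agree
on P, so the twist respects multiplicities: the block of χ is isomorphic to the block of χ ∘ j.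

Each character of B is the restriction of exactly |A|/|B| = |E|/|F| characters of A
(`exists_characterEquiv`), so each block of F occurs that many times in E. -/

/-- The hypothesis lets θ factor through the image of K in the abelianization of P; a character of a
subgroup of a finite abelian group extends to the whole group. -/
theorem exists_linearCharacter_extension {P K : Type*} [Group P] [Finite P] [Group K]
    (m : K →* P) (θ : K →* ℂˣ) (h : ∀ k, m k ∈ commutator P → θ k = 1) :
    ∃ μ : P →* ℂˣ, ∀ k, μ (m k) = θ k := by
  let φ : K →* Abelianization P := Abelianization.of.comp m
  have hker : φ.rangeRestrict.ker ≤ θ.ker := by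
    intro k hk
    rw [MonoidHom.ker_rangeRestrict, MonoidHom.mem_ker] at hk
    refine h k ?_
    rw [← Abelianization.ker_of]
    exact hk
  let θ' : φ.range →* ℂˣ := φ.rangeRestrict.liftOfSurjective φ.rangeRestrict_surjective ⟨θ, hker⟩
  -- Finiteness and a nonzero exponent in ℂ provide the roots of unity needed for the extension.
  have : Finite (Abelianization P) := inferInstanceAs (Finite (P ⧸ commutator P))
  have : NeZero ((Monoid.exponent (Abelianization P) : ℕ) : ℂ) :=
    ⟨Nat.cast_ne_zero.2 Monoid.exponent_ne_zero_of_finite⟩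
  obtain ⟨μ, hμ⟩ := MonoidHom.domRestrict_surjective ℂ φ.range θ'
  refine ⟨μ.comp Abelianization.of, fun k => ?_⟩
  have h1 := DFunLike.congr_fun hμ (φ.rangeRestrict k)
  refine Eq.trans ?_ (h1.trans ?_)
  · rfl
  · exact MonoidHom.liftOfRightInverse_comp_apply _ _ _ ⟨θ, hker⟩ k

/-! ### Representations that agree up to a linear character -/

section Twist

variable {P E F : Type*} [Group P] [Group E] [Group F]

/-- The linear isomorphism `u` identifies the twist by `μ` of the inflation of `ρ` along `p` with the
inflation of `σ` along `q`. -/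
def IsTwist (p : P →* E) (q : P →* F) (μ : P →* ℂˣ) {W W' : Type*} [AddCommGroup W] [Module ℂ W]
    [AddCommGroup W'] [Module ℂ W'] (ρ : Representation ℂ E W) (σ : Representation ℂ F W')
    (u : W ≃ₗ[ℂ] W') : Prop :=
  ∀ x w, u ((μ x : ℂ) • ρ (p x) w) = σ (q x) (u w)

variable {p : P →* E} {q : P →* F} {μ : P →* ℂˣ}
  {W W' W₁ W₁' W₂ W₂' : Type*} [AddCommGroup W] [Module ℂ W] [AddCommGroup W'] [Module ℂ W']
  [AddCommGroup W₁] [Module ℂ W₁] [AddCommGroup W₁'] [Module ℂ W₁']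
  [AddCommGroup W₂] [Module ℂ W₂] [AddCommGroup W₂'] [Module ℂ W₂']
  {ρ : Representation ℂ E W} {σ : Representation ℂ F W'} {u : W ≃ₗ[ℂ] W'}
  {ρ₁ : Representation ℂ E W₁} {σ₁ : Representation ℂ F W₁'} {u₁ : W₁ ≃ₗ[ℂ] W₁'}
  {ρ₂ : Representation ℂ E W₂} {σ₂ : Representation ℂ F W₂'} {u₂ : W₂ ≃ₗ[ℂ] W₂'}

namespace IsTwist

/-- This symmetry between E and F lets each one-sided construction below serve in both directions.
-/
theorem symm (h : IsTwist p q μ ρ σ u) : IsTwist q p μ⁻¹ σ ρ u.symm := by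
  intro x w
  obtain ⟨v, rfl⟩ := u.surjective w
  rw [map_smul, ← h, u.symm_apply_apply, u.symm_apply_apply, smul_smul]
  simp

/-- Transport of intertwining maps. -/
def intertwiningMap (hq : Function.Surjective q) (h₁ : IsTwist p q μ ρ₁ σ₁ u₁)
    (h₂ : IsTwist p q μ ρ₂ σ₂ u₂) (f : Representation.IntertwiningMap ρ₁ ρ₂) :
    Representation.IntertwiningMap σ₁ σ₂ where
  toLinearMap := u₂.toLinearMap ∘ₗ f.toLinearMap ∘ₗ u₁.symm.toLinearMap
  isIntertwining' := fun y => by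
    obtain ⟨x, rfl⟩ := hq y
    refine LinearMap.ext fun w => ?_
    obtain ⟨v, rfl⟩ := u₁.surjective w
    change u₂ (f (u₁.symm (σ₁ (q x) (u₁ v)))) = σ₂ (q x) (u₂ (f (u₁.symm (u₁ v))))
    rw [← h₁, u₁.symm_apply_apply, u₁.symm_apply_apply, ← h₂, map_smul,
      Representation.IntertwiningMap.isIntertwining]

/-- Intertwining maps correspond to each other. -/
def intertwiningEquiv (hp : Function.Surjective p) (hq : Function.Surjective q)
    (h₁ : IsTwist p q μ ρ₁ σ₁ u₁) (h₂ : IsTwist p q μ ρ₂ σ₂ u₂) :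
    Representation.IntertwiningMap ρ₁ ρ₂ ≃ₗ[ℂ] Representation.IntertwiningMap σ₁ σ₂ where
  toFun := intertwiningMap hq h₁ h₂
  invFun := intertwiningMap hp h₁.symm h₂.symm
  left_inv f := Representation.IntertwiningMap.ext (LinearMap.ext fun w => by
    change u₂.symm (u₂ (f (u₁.symm (u₁ w)))) = f w
    simp)
  right_inv f := Representation.IntertwiningMap.ext (LinearMap.ext fun w => by
    change u₂ (u₂.symm (f (u₁ (u₁.symm w)))) = f w
    simp)
  map_add' f g := Representation.IntertwiningMap.ext (LinearMap.ext fun w =>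
    u₂.map_add (f (u₁.symm w)) (g (u₁.symm w)))
  map_smul' c f := Representation.IntertwiningMap.ext (LinearMap.ext fun w =>
    u₂.map_smul c (f (u₁.symm w)))

/-- As α and β agree on P, the scalar μ(x) can be moved into the second tensor factor. -/
theorem tprod {U : Type*} [AddCommGroup U] [Module ℂ U] (α : Representation ℂ E U)
    (β : Representation ℂ F U) (hαβ : ∀ x, α (p x) = β (q x)) (h : IsTwist p q μ ρ σ u) :
    IsTwist p q μ (α.tprod ρ) (β.tprod σ) (LinearEquiv.lTensor U u) := by
  intro x t
  induction t using TensorProduct.induction_on with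
  | zero => simp
  | add s t hs ht => simp only [map_add, smul_add, hs, ht]
  | tmul v w =>
    simp only [Representation.tprod_apply, TensorProduct.map_tmul, LinearEquiv.lTensor_tmul,
      ← h x w, hαβ, map_smul, TensorProduct.tmul_smul]

/-- Transport of subrepresentations. -/
def subrepresentation (hq : Function.Surjective q) (h : IsTwist p q μ ρ σ u)
    (S : Subrepresentation ρ) : Subrepresentation σ where
  toSubmodule := S.toSubmodule.map u.toLinearMap
  apply_mem_toSubmodule y w hw := by
    obtain ⟨x, rfl⟩ := hq y
    obtain ⟨v, hv, rfl⟩ := hw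
    exact ⟨_, S.toSubmodule.smul_mem _ (S.apply_mem_toSubmodule (p x) hv), h x v⟩

/-- Scalars preserve subspaces, so twisting does not change the lattice of subrepresentations. -/
theorem isIrreducible (hp : Function.Surjective p) (hq : Function.Surjective q)
    (h : IsTwist p q μ ρ σ u) (hρ : ρ.IsIrreducible) : σ.IsIrreducible := by
  let e : Subrepresentation ρ ≃o Subrepresentation σ :=
    { toFun := subrepresentation hq h
      invFun := subrepresentation hp h.symm
      left_inv := fun S => Subrepresentation.toSubmodule_injective (by
        ext w
        simp [subrepresentation])
      right_inv := fun S => Subrepresentation.toSubmodule_injective (by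
        ext w
        simp [subrepresentation])
      map_rel_iff' := fun {S T} =>
        Submodule.map_le_map_iff_of_injective u.injective S.toSubmodule T.toSubmodule }
  exact e.isSimpleOrder_iff.1 hρ

/-- Two twists of the same representation are equivalent. -/
theorem equiv {u₁' : W ≃ₗ[ℂ] W₁} {u₂' : W ≃ₗ[ℂ] W₂} {σ₁ : Representation ℂ F W₁}
    {σ₂ : Representation ℂ F W₂} (hq : Function.Surjective q) (h₁ : IsTwist p q μ ρ σ₁ u₁')
    (h₂ : IsTwist p q μ ρ σ₂ u₂') :
    Nonempty (σ₁.Equiv σ₂) := by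
  refine ⟨Representation.Equiv.mk (u₁'.symm.trans u₂') fun y => LinearMap.ext fun w => ?_⟩
  obtain ⟨x, rfl⟩ := hq y
  obtain ⟨v, rfl⟩ := u₁'.surjective w
  change u₂' (u₁'.symm (σ₁ (q x) (u₁' v))) = σ₂ (q x) (u₂' (u₁'.symm (u₁' v)))
  rw [← h₁, u₁'.symm_apply_apply, u₁'.symm_apply_apply, h₂]

theorem trans_equiv (h : IsTwist p q μ ρ σ u) {σ' : Representation ℂ F W₁} (e : σ.Equiv σ') :
    IsTwist p q μ ρ σ' (u.trans e.toLinearEquiv) := by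
  intro x w
  change e (u _) = σ' (q x) (e (u w))
  rw [h]
  exact Representation.IntertwiningMap.isIntertwining _ _ e.toIntertwiningMap (q x) (u w)

end IsTwist

/-- The twist of the inflation of `ρ` descends along `q` once `ker q` acts trivially. -/
theorem exists_isTwist (hq : Function.Surjective q) (ρ : Representation ℂ E W)
    (h : ∀ x, q x = 1 → ∀ w, (μ x : ℂ) • ρ (p x) w = w) :
    ∃ σ : Representation ℂ F W, IsTwist p q μ ρ σ (LinearEquiv.refl ℂ W) := by
  let τ : P →* (W →ₗ[ℂ] W) :=
    { toFun := fun x => (μ x : ℂ) • ρ (p x)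
      map_one' := by simp
      map_mul' := fun x y => by
        simp only [map_mul, Units.val_mul, smul_mul_smul_comm] }
  have hτ : ∀ x y, q x = q y → τ x = τ y := by
    intro x y hxy
    have h1 : τ (y⁻¹ * x) = 1 := LinearMap.ext fun w => h _ (by simp [hxy]) w
    rw [← mul_inv_cancel_left y x, map_mul, h1, mul_one]
  -- A set-theoretic section of q suffices, since τ is constant on the fibers of q.
  let s := Function.surjInv hq
  have hs : ∀ y, q (s y) = y := Function.surjInv_eq hq
  let σ : Representation ℂ F W :=
    { toFun := fun y => τ (s y)
      map_one' := by rw [hτ (s 1) 1 (by rw [hs, map_one]), map_one]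
      map_mul' := fun y z => by
        rw [← map_mul]; exact hτ _ _ (by rw [map_mul, hs, hs, hs]) }
  exact ⟨σ, fun x w => congrArg (fun f => f w) (hτ x (s (q x)) (hs _).symm)⟩

/-- Existence of the corresponding class of irreducible representations. -/
theorem exists_irr_isTwist (hp : Function.Surjective p) (hq : Function.Surjective q) (i : Irr E)
    (h : ∀ x, q x = 1 → ∀ w, (μ x : ℂ) • i.rep (p x) w = w) :
    ∃ (j : Irr F) (u : _ ≃ₗ[ℂ] _), IsTwist p q μ i.rep j.rep u := by
  obtain ⟨σ, hσ⟩ := exists_isTwist hq i.rep h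
  obtain ⟨j, ⟨e⟩⟩ := Irr.exists_equiv σ (hσ.isIrreducible hp hq i.rep_irreducible)
  exact ⟨j, _, hσ.trans_equiv e⟩

/-- The equality i = i' is a separate hypothesis because the spaces depend on the classes, which
need not be variables where the lemma is applied. -/
theorem eq_of_isTwist (hq : Function.Surjective q) {i i' : Irr E} {j j' : Irr F} (hi : i = i')
    {v : (Fin (Quotient.out i).dim → ℂ) ≃ₗ[ℂ] (Fin (Quotient.out j).dim → ℂ)}
    {v' : (Fin (Quotient.out i').dim → ℂ) ≃ₗ[ℂ] (Fin (Quotient.out j').dim → ℂ)}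
    (h : IsTwist p q μ i.rep j.rep v) (h' : IsTwist p q μ i'.rep j'.rep v') : j = j' := by
  subst hi
  exact Irr.eq_of_equiv (h.equiv hq h').some

/-- Both arguments of Hom(ρ_{i'}, α ⊗ ρ_i) are twisted by the same μ, which therefore cancels. -/
theorem mckayMatrix_eq_of_isTwist {V : Type*} [AddCommGroup V] [Module ℂ V]
    (hp : Function.Surjective p) (hq : Function.Surjective q) (α : Representation ℂ E V)
    (β : Representation ℂ F V) (hαβ : ∀ x, α (p x) = β (q x)) {i i' : Irr E} {j j' : Irr F}
    {v : (Fin (Quotient.out i).dim → ℂ) ≃ₗ[ℂ] (Fin (Quotient.out j).dim → ℂ)}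
    {v' : (Fin (Quotient.out i').dim → ℂ) ≃ₗ[ℂ] (Fin (Quotient.out j').dim → ℂ)}
    (h : IsTwist p q μ i.rep j.rep v) (h' : IsTwist p q μ i'.rep j'.rep v') :
    mckayMatrix α i i' = mckayMatrix β j j' :=
  (IsTwist.intertwiningEquiv hp hq h' (h.tprod α β hαβ)).finrank_eq

end Twist

/-! ### Central characters -/

instance Irr.nontrivial_space {E : Type*} [Group E] (i : Irr E) :
    Nontrivial (Fin (Quotient.out i).dim → ℂ) := by
  have : Nontrivial i.rep.asModule :=
    have := (Representation.irreducible_iff_isSimpleModule_asModule i.rep).1 inferInstance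
    IsSimpleModule.nontrivial (MonoidAlgebra ℂ E) _
  exact this

/-- `χ` is the character by which `A` acts on `ρ` through `m`. -/
def HasCharacter {A E W : Type*} [Group A] [Group E] [AddCommGroup W] [Module ℂ W] (m : A →* E)
    (ρ : Representation ℂ E W) (χ : A →* ℂˣ) : Prop :=
  ∀ a w, ρ (m a) w = (χ a : ℂ) • w

section CentralCharacter

variable {A E : Type*} [Group A] [Group E] {m : A →* E}

theorem HasCharacter.eq {W : Type*} [AddCommGroup W] [Module ℂ W] [Nontrivial W]
    {ρ : Representation ℂ E W} {χ χ' : A →* ℂˣ} (h : HasCharacter m ρ χ)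
    (h' : HasCharacter m ρ χ') : χ = χ' := by
  obtain ⟨w, hw⟩ := exists_ne (0 : W)
  ext a
  exact smul_left_injective ℂ hw ((h a w).symm.trans (h' a w))

/-- Schur's lemma: central elements act by scalars. Evaluation at a nonzero vector shows that the
scalars are multiplicative. -/
theorem Irr.exists_hasCharacter (hm : m.range ≤ Subgroup.center E) (i : Irr E) :
    ∃ χ : A →* ℂˣ, HasCharacter m i.rep χ := by
  have hs : ∀ a, ∃ c : ℂ, ∀ w, i.rep (m a) w = c • w := by
    intro a
    have ha : m a ∈ Submonoid.center E := hm ⟨a, rfl⟩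
    obtain ⟨c, hc⟩ :=
      (Representation.IsIrreducible.algebraMap_intertwiningMap_bijective_of_isAlgClosed
        (ρ := i.rep)).2 (Representation.IntertwiningMap.centralMul i.rep (m a) ha)
    exact ⟨c, fun w => (congrArg (fun f => f w) hc).symm⟩
  choose c hc using hs
  obtain ⟨w, hw⟩ := exists_ne (0 : Fin (Quotient.out i).dim → ℂ)
  have hinj := smul_left_injective ℂ hw
  let χ : A →* ℂ :=
    { toFun := c
      map_one' := hinj (by simp [← hc])
      map_mul' := fun a b => hinj (by
        simp only [← hc, map_mul, Module.End.mul_apply]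
        rw [hc b, map_smul, hc a, smul_smul, mul_comm]) }
  exact ⟨χ.toHomUnits, fun a w => hc a w⟩

/-- The character by which the central subgroup `A` acts on an irreducible representation. -/
def Irr.centralCharacter (hm : m.range ≤ Subgroup.center E) (i : Irr E) : A →* ℂˣ :=
  (i.exists_hasCharacter hm).choose

theorem Irr.hasCharacter (hm : m.range ≤ Subgroup.center E) (i : Irr E) :
    HasCharacter m i.rep (i.centralCharacter hm) :=
  (i.exists_hasCharacter hm).choose_spec

/-- Tensoring with a representation on which `A` acts trivially preserves central characters. -/
theorem mckayMatrix_eq_zero {V : Type*} [AddCommGroup V] [Module ℂ V]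
    (hm : m.range ≤ Subgroup.center E) (α : Representation ℂ E V) (hα : ∀ a, α (m a) = 1)
    {i i' : Irr E} (h : i.centralCharacter hm ≠ i'.centralCharacter hm) :
    mckayMatrix α i i' = 0 := by
  have ht : HasCharacter m (α.tprod i.rep) (i.centralCharacter hm) := by
    intro a t
    induction t using TensorProduct.induction_on with
    | zero => simp
    | add s t hs ht => simp only [map_add, smul_add, hs, ht]
    | tmul v w => simp [hα, i.hasCharacter hm a w]
  have hz : ∀ f : Representation.IntertwiningMap i'.rep (α.tprod i.rep), f = 0 := by
    intro f
    by_contra hf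
    -- A nonzero f is injective, so the character of the target also describes the action on the
    -- source.
    have hi := (Representation.IsIrreducible.injective_or_eq_zero f).resolve_right hf
    refine h (HasCharacter.eq (ρ := i'.rep) (fun a w => hi ?_) (i'.hasCharacter hm))
    rw [Representation.IntertwiningMap.isIntertwining, ht, map_smul]
  have : Subsingleton (Representation.IntertwiningMap i'.rep (α.tprod i.rep)) :=
    ⟨fun f g => (hz f).trans (hz g).symm⟩
  exact Module.finrank_zero_of_subsingleton

end CentralCharacter

/-! ### Isoclinic extensions -/

namespace GroupExtension

theorem rightHom_inl_apply {A E G : Type*} [Group A] [Group E] [Group G]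
    (S : GroupExtension A E G) (a : A) : S.rightHom (S.inl a) = 1 := by
  have h : S.inl a ∈ S.inl.range := ⟨a, rfl⟩
  rwa [S.range_inl_eq_ker_rightHom] at h

theorem exists_inl_eq {A E G : Type*} [Group A] [Group E] [Group G]
    (S : GroupExtension A E G) {e : E} (h : S.rightHom e = 1) : ∃ a, S.inl a = e := by
  have h' : e ∈ S.rightHom.ker := h
  rwa [← S.range_inl_eq_ker_rightHom] at h'

theorem card_eq {A E G : Type*} [Group A] [Group E] [Group G] (S : GroupExtension A E G) :
    Nat.card E = Nat.card G * Nat.card A := by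
  rw [Subgroup.card_eq_card_quotient_mul_card_subgroup S.rightHom.ker,
    Nat.card_congr (QuotientGroup.quotientKerEquivOfSurjective _ S.rightHom_surjective).toEquiv,
    ← S.range_inl_eq_ker_rightHom,
    Nat.card_congr (MonoidHom.ofInjective S.inl_injective).toEquiv]

end GroupExtension

/-! ### The fiber product over G and the embedding of B into A -/

section FiberProduct

variable {A E B F G : Type*} [Group A] [Group E] [Group B] [Group F] [Group G]
  (S : GroupExtension A E G) (T : GroupExtension B F G)

/-- The fiber product `E ×_G F`. -/
def fiberProduct : Subgroup (E × F) :=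
  (S.rightHom.comp (MonoidHom.fst E F)).eqLocus (T.rightHom.comp (MonoidHom.snd E F))

/-- The projection to `E`. -/
def fiberProduct.fst : fiberProduct S T →* E := (MonoidHom.fst E F).comp (fiberProduct S T).subtype

/-- The projection to `F`. -/
def fiberProduct.snd : fiberProduct S T →* F := (MonoidHom.snd E F).comp (fiberProduct S T).subtype

/-- The inclusion of the kernel `A × B` of the projection to `G`. -/
def fiberProduct.inl : A × B →* fiberProduct S T :=
  (S.inl.prodMap T.inl).codRestrict _ fun x =>
    (S.rightHom_inl_apply x.1).trans (T.rightHom_inl_apply x.2).symm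

variable {S T}

theorem fiberProduct.rightHom_fst (x : fiberProduct S T) :
    S.rightHom (fiberProduct.fst S T x) = T.rightHom (fiberProduct.snd S T x) := x.2

theorem fiberProduct.fst_surjective : Function.Surjective (fiberProduct.fst S T) := by
  intro e
  obtain ⟨f, hf⟩ := T.rightHom_surjective (S.rightHom e)
  exact ⟨⟨(e, f), hf.symm⟩, rfl⟩

theorem fiberProduct.snd_surjective : Function.Surjective (fiberProduct.snd S T) := by
  intro f
  obtain ⟨e, he⟩ := S.rightHom_surjective (T.rightHom f)
  exact ⟨⟨(e, f), he⟩, rfl⟩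

theorem fiberProduct.exists_of_snd_eq_one {x : fiberProduct S T}
    (h : fiberProduct.snd S T x = 1) : ∃ a, x = fiberProduct.inl S T (a, 1) := by
  obtain ⟨a, ha⟩ := S.exists_inl_eq (e := fiberProduct.fst S T x)
    (by rw [fiberProduct.rightHom_fst, h, map_one])
  refine ⟨a, Subtype.ext (Prod.ext ha.symm ?_)⟩
  exact h.trans T.inl.map_one.symm

theorem fiberProduct.exists_of_fst_eq_one {x : fiberProduct S T}
    (h : fiberProduct.fst S T x = 1) : ∃ b, x = fiberProduct.inl S T (1, b) := by
  obtain ⟨b, hb⟩ := T.exists_inl_eq (e := fiberProduct.snd S T x)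
    (by rw [← fiberProduct.rightHom_fst, h, map_one])
  refine ⟨b, Subtype.ext (Prod.ext ?_ hb.symm)⟩
  exact h.trans S.inl.map_one.symm

variable {I : Isoclinism E F}
  (hI : ∀ (e : E) (f : F), S.rightHom e = T.rightHom f →
    I.η (e : E ⧸ Subgroup.center E) = (f : F ⧸ Subgroup.center F))

include hI in
/-- The derived subgroup of the fiber product is contained in the graph of `ν`. -/
theorem Isoclinism.exists_coe_eq_fst {x : fiberProduct S T} (hx : x ∈ commutator (fiberProduct S T)) :
    ∃ c : commutator E, (c : E) = fiberProduct.fst S T x ∧ (I.ν c : F) = fiberProduct.snd S T x := by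
  rw [commutator_eq_closure] at hx
  induction hx using Subgroup.closure_induction with
  | mem x hx =>
    obtain ⟨y, z, rfl⟩ := hx
    refine ⟨⟨_, Subgroup.commutator_mem_commutator (Subgroup.mem_top _) (Subgroup.mem_top _)⟩,
      (map_commutatorElement (fiberProduct.fst S T) y z).symm, ?_⟩
    exact (I.comm _ _ _ _ (hI _ _ (fiberProduct.rightHom_fst y))
      (hI _ _ (fiberProduct.rightHom_fst z))).trans (map_commutatorElement _ y z).symm
  | one => exact ⟨1, by simp, by simp⟩
  | mul x y _ _ hx hy =>
    obtain ⟨c, hc, ec⟩ := hx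
    obtain ⟨d, hd, ed⟩ := hy
    exact ⟨c * d, by simp [hc, hd], by simp [ec, ed]⟩
  | inv x _ hx =>
    obtain ⟨c, hc, ec⟩ := hx
    exact ⟨c⁻¹, by simp [hc], by simp [ec]⟩

include hI in
/-- The isomorphism `ν` lies over `G`. -/
theorem Isoclinism.rightHom_ν (x : commutator E) : T.rightHom (I.ν x) = S.rightHom x := by
  -- Every element of [E, E] lifts to [P, P], and the second coordinate of such a lift is its image
  -- under ν.
  have hmap : commutator E ≤ (commutator (fiberProduct S T)).map (fiberProduct.fst S T) := by
    rw [commutator_def (fiberProduct S T), Subgroup.map_commutator,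
      Subgroup.map_top_of_surjective _ fiberProduct.fst_surjective, commutator_def]
  obtain ⟨z, hz, hx⟩ := hmap x.2
  obtain ⟨c, hc, e⟩ := Isoclinism.exists_coe_eq_fst hI hz
  obtain rfl : c = x := Subtype.ext (hc.trans hx)
  rw [e, hc, fiberProduct.rightHom_fst]

include hI in
/-- The inverse of `ν` embeds `B` into `A` when `B` is the kernel of a stem extension. -/
theorem IsStemExtension.exists_injective_hom (hT : IsStemExtension T) :
    ∃ j : B →* A, Function.Injective j ∧
      ∀ (c : commutator E) b, (I.ν c : F) = T.inl b → (c : E) = S.inl (j b) := by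
  -- The stem condition places B in [F, F], where ν⁻¹ is defined; since ν lies over G, ν⁻¹ sends B
  -- into the kernel A.
  let κ : B →* commutator F := T.inl.codRestrict _ fun b => (hT ⟨b, rfl⟩).2
  let δ : B →* E := (commutator E).subtype.comp (I.ν.symm.toMonoidHom.comp κ)
  have hδ : ∀ b, δ b ∈ S.inl.range := by
    intro b
    rw [S.range_inl_eq_ker_rightHom, MonoidHom.mem_ker]
    refine (Isoclinism.rightHom_ν hI (I.ν.symm (κ b))).symm.trans ?_
    rw [I.ν.apply_symm_apply]
    exact T.rightHom_inl_apply b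
  let j : B →* A := (MonoidHom.ofInjective S.inl_injective).symm.toMonoidHom.comp
    (δ.codRestrict _ hδ)
  have hj : ∀ b, S.inl (j b) = δ b := fun b =>
    congrArg Subtype.val ((MonoidHom.ofInjective S.inl_injective).apply_symm_apply ⟨δ b, hδ b⟩)
  have hν : ∀ (c : commutator E) b, (I.ν c : F) = T.inl b → (c : E) = S.inl (j b) := by
    intro c b h
    have h1 : I.ν c = κ b := Subtype.ext h
    rw [hj, ← I.ν.symm_apply_apply c, h1]
    rfl
  refine ⟨j, fun b c hbc => ?_, hν⟩
  have h1 : δ b = δ c := by rw [← hj, ← hj, hbc]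
  exact T.inl_injective (congrArg Subtype.val (I.ν.symm.injective (Subtype.ext h1)))

end FiberProduct

/-! ### Characters of the kernels -/

/-- For an injective homomorphism `j : B → A` of finite abelian groups, the characters of `A` are
parametrized by the characters of `B` and `|A| / |B|` labels. -/
theorem exists_characterEquiv {A B : Type*} [CommGroup A] [Finite A] [Group B]
    (j : B →* A) (hj : Function.Injective j) :
    ∃ e : (A →* ℂˣ) ≃ Fin (Nat.card A / Nat.card B) × (B →* ℂˣ), ∀ χ, (e χ).2 = χ.comp j := by
  let _ : CommGroup B :=
    { ‹Group B› with mul_comm := fun a b => hj (by rw [map_mul, map_mul, mul_comm]) }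
  have : Finite B := Finite.of_injective j hj
  let r : (A →* ℂˣ) →* (B →* ℂˣ) := MonoidHom.compHom' j
  have hr : Function.Surjective r := fun ψ => by
    obtain ⟨χ, hχ⟩ := exists_linearCharacter_extension j ψ fun b hb => by
      rw [(commutator_eq_bot_iff_center_eq_top A).2 CommGroup.center_eq_top, Subgroup.mem_bot] at hb
      rw [hj (hb.trans (map_one j).symm), map_one]
    exact ⟨χ, MonoidHom.ext hχ⟩
  have : NeZero ((Monoid.exponent A : ℕ) : ℂ) :=
    ⟨Nat.cast_ne_zero.2 Monoid.exponent_ne_zero_of_finite⟩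
  have : NeZero ((Monoid.exponent B : ℕ) : ℂ) :=
    ⟨Nat.cast_ne_zero.2 Monoid.exponent_ne_zero_of_finite⟩
  have : Finite (A →* ℂˣ) :=
    .of_equiv A (CommGroup.monoidHom_mulEquiv_of_hasEnoughRootsOfUnity A ℂ).some.symm.toEquiv
  -- A finite abelian group has as many characters as elements, so the order of the kernel of
  -- restriction is the quotient of the two orders.
  have hk : Nat.card r.ker = Nat.card A / Nat.card B := by
    rw [← CommGroup.card_monoidHom_of_hasEnoughRootsOfUnity A ℂ,
      ← CommGroup.card_monoidHom_of_hasEnoughRootsOfUnity B ℂ,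
      Subgroup.card_eq_card_quotient_mul_card_subgroup r.ker,
      Nat.card_congr (QuotientGroup.quotientKerEquivOfSurjective r hr).toEquiv,
      Nat.mul_div_cancel_left]
    rw [CommGroup.card_monoidHom_of_hasEnoughRootsOfUnity B ℂ]
    exact Nat.card_pos
  let l : r.ker ≃ Fin (Nat.card A / Nat.card B) := (Finite.equivFin r.ker).trans (finCongr hk)
  -- A set-theoretic section s of restriction chooses a base point in each fiber; χ is labeled by
  -- its quotient by the base point.
  let s := Function.surjInv hr
  have hs : ∀ ψ, r (s ψ) = ψ := Function.surjInv_eq hr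
  have hker : ∀ χ, χ / s (r χ) ∈ r.ker := fun χ => by
    exact (map_div r _ _).trans (by rw [hs]; exact div_self' _)
  have hl : ∀ n ψ, r ((l.symm n : A →* ℂˣ) * s ψ) = ψ := fun n ψ => by
    rw [map_mul, hs, (l.symm n).2, one_mul]
  refine ⟨⟨fun χ => (l ⟨χ / s (r χ), hker χ⟩, r χ), fun x => (l.symm x.1 : A →* ℂˣ) * s x.2,
    fun χ => ?_, fun ⟨n, ψ⟩ => Prod.ext ?_ (hl n ψ)⟩, fun _ => rfl⟩
  · simp only [Equiv.symm_apply_apply]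
    exact MonoidHom.ext fun a => div_mul_cancel (χ a) (s (r χ) a)
  · refine l.symm.injective (Subtype.ext ?_)
    simp only [hl, Equiv.symm_apply_apply]
    exact MonoidHom.ext fun a => mul_div_cancel_right ((l.symm n : A →* ℂˣ) a) (s ψ a)

/-- The character of the fiber product that compares the central characters `χ` and `χ ∘ j`. -/
theorem exists_comparisonCharacter {A E B F G : Type*} [Group A] [Group E] [Group B] [Group F]
    [Group G] [Finite E] [Finite F] {S : GroupExtension A E G} {T : GroupExtension B F G}
    {I : Isoclinism E F}
    (hI : ∀ (e : E) (f : F), S.rightHom e = T.rightHom f →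
      I.η (e : E ⧸ Subgroup.center E) = (f : F ⧸ Subgroup.center F))
    {j : B →* A} (hj : ∀ (c : commutator E) b, (I.ν c : F) = T.inl b → (c : E) = S.inl (j b))
    (χ : A →* ℂˣ) :
    ∃ μ : fiberProduct S T →* ℂˣ, ∀ a b,
      μ (fiberProduct.inl S T (a, b)) = (χ a)⁻¹ * χ (j b) := by
  obtain ⟨μ, hμ⟩ := exists_linearCharacter_extension (fiberProduct.inl S T)
    ((χ⁻¹).coprod (χ.comp j)) fun k hk => by
      -- A pair (a, b) in [P, P] lies on the graph of ν, so a = j b and the two factors cancel.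
      obtain ⟨c, hc, ec⟩ := Isoclinism.exists_coe_eq_fst hI hk
      have h1 : S.inl k.1 = S.inl (j k.2) := hc.symm.trans (hj c k.2 ec)
      simp [S.inl_injective h1]
  exact ⟨μ, fun a b => hμ (a, b)⟩

end

/-! ### The quiver isomorphism -/

theorem mainTheorem2 {A E B F G V : Type*} [Group A] [Group E] [Group B] [Group F] [Group G]
    [Finite E] [Finite F] [AddCommGroup V] [Module ℂ V] [FiniteDimensional ℂ V]
    (S : GroupExtension A E G) (hS : IsCentralExtension S)
    (T : GroupExtension B F G) (hT : IsStemExtension T)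
    (hST : IsoclinicExtensions S T)
    (R : Representation ℂ G V) (hR : Function.Injective R) :
    Nat.card F ∣ Nat.card E ∧
      Nonempty (QuiverIso (McKayQuiver (R.comp S.rightHom))
        (QuiverCopies (Nat.card E / Nat.card F) (McKayQuiver (R.comp T.rightHom)))) := by
  obtain ⟨I, hI⟩ := hST
  obtain ⟨j, hj, hIj⟩ := IsStemExtension.exists_injective_hom hI hT
  have : Finite A := Finite.of_injective _ S.inl_injective
  have : Finite G := Finite.of_surjective _ S.rightHom_surjective
  let _ : CommGroup A :=
    { ‹Group A› with
      mul_comm := fun a b => S.inl_injective (by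
        rw [map_mul, map_mul]
        exact ((Subgroup.mem_center_iff.1 (hS ⟨b, rfl⟩)) _)) }
  have hcard : Nat.card E / Nat.card F = Nat.card A / Nat.card B := by
    rw [S.card_eq, T.card_eq, Nat.mul_div_mul_left _ _ Nat.card_pos]
  refine ⟨?_, ?_⟩
  · rw [S.card_eq, T.card_eq]
    exact mul_dvd_mul_left _ (Subgroup.card_dvd_of_injective j hj)
  have hT' : T.inl.range ≤ Subgroup.center F := hT.trans inf_le_left
  obtain ⟨e, he⟩ := exists_characterEquiv j hj
  rw [hcard]
  -- Here μ depends only on χ, so all classes in one block are twisted by the same character.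
  choose μ hμ using exists_comparisonCharacter hI hIj
  let p := fiberProduct.fst S T
  let q := fiberProduct.snd S T
  have hp : Function.Surjective p := fiberProduct.fst_surjective
  have hq : Function.Surjective q := fiberProduct.snd_surjective
  let c : Irr E → (A →* ℂˣ) := Irr.centralCharacter hS
  let d : Irr F → (B →* ℂˣ) := Irr.centralCharacter hT'
  -- the class of `F` that corresponds to a class of `E`
  have h1 : ∀ i : Irr E, ∃ (k : Irr F) (u : _ ≃ₗ[ℂ] _), IsTwist p q (μ (c i)) i.rep k.rep u := by
    intro i
    refine exists_irr_isTwist hp hq i fun x hx w => ?_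
    obtain ⟨a, rfl⟩ := fiberProduct.exists_of_snd_eq_one hx
    have h : i.rep (p (fiberProduct.inl S T (a, 1))) w = _ := i.hasCharacter hS a w
    rw [h, smul_smul, hμ, ← Units.val_mul]
    simp [c]
  choose f u hu using h1
  have h2 : ∀ i, d (f i) = (c i).comp j := by
    intro i
    refine HasCharacter.eq ((f i).hasCharacter hT') fun b w => ?_
    obtain ⟨v, rfl⟩ := (u i).surjective w
    have h := hu i (fiberProduct.inl S T (1, b)) v
    have h3 : p (fiberProduct.inl S T (1, b)) = 1 := S.inl.map_one
    rw [hμ, h3, map_one, map_one] at h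
    refine Eq.trans h.symm ?_
    simp
  -- The copy is the label of the central character of i among the characters of A with the same
  -- restriction to B.
  let φ : Irr E → Fin (Nat.card A / Nat.card B) × Irr F := fun i => ((e (c i)).1, f i)
  have h3 : ∀ i, e (c i) = ((φ i).1, d (f i)) := fun i => Prod.ext rfl ((he _).trans (h2 i).symm)
  have hinj : Function.Injective φ := by
    intro i i' h
    have hf : f i = f i' := congrArg Prod.snd h
    -- The label and the character of B together recover the character of A, so both classes are
    -- untwisted by the same μ.
    have hc : c i = c i' := e.injective (by rw [h3, h3, h, hf])
    have hi := (hu i).symm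
    have hi' := (hu i').symm
    rw [hc] at hi
    exact eq_of_isTwist hp hf hi hi'
  have hsurj : Function.Surjective φ := by
    rintro ⟨n, k⟩
    obtain ⟨χ, hχ⟩ := e.surjective (n, d k)
    have hχ' : χ.comp j = d k := by rw [← he, hχ]
    obtain ⟨i, v, hv⟩ : ∃ (i : Irr E) (v : _ ≃ₗ[ℂ] _), IsTwist q p (μ χ)⁻¹ k.rep i.rep v := by
      refine exists_irr_isTwist hq hp k fun x hx w => ?_
      obtain ⟨b, rfl⟩ := fiberProduct.exists_of_fst_eq_one hx
      have h : k.rep (q (fiberProduct.inl S T (1, b))) w = _ := k.hasCharacter hT' b w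
      have hb : χ (j b) = k.centralCharacter hT' b := DFunLike.congr_fun hχ' b
      rw [h, smul_smul, MonoidHom.inv_apply, hμ, ← Units.val_mul, hb]
      simp
    have hv' := hv.symm
    rw [show (μ χ)⁻¹⁻¹ = μ χ from MonoidHom.ext fun x => inv_inv (μ χ x)] at hv'
    -- This ensures that `f i` was built with the same twist `μ χ`, which makes it equal to k.
    have hc : c i = χ := by
      refine HasCharacter.eq (i.hasCharacter hS) fun a w => ?_
      obtain ⟨w', rfl⟩ := v.surjective w
      have h := hv (fiberProduct.inl S T (a, 1)) w'
      have h4 : q (fiberProduct.inl S T (a, 1)) = 1 := T.inl.map_one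
      rw [MonoidHom.inv_apply, hμ, h4, map_one, map_one] at h
      refine Eq.trans h.symm ?_
      simp
    have hui := hu i
    rw [hc] at hui
    refine ⟨i, Prod.ext ?_ ?_⟩
    · change (e (c i)).1 = n
      rw [hc, hχ]
    · exact eq_of_isTwist hq rfl hui hv'
  have hE : ∀ i i', c i ≠ c i' → mckayMatrix (R.comp S.rightHom) i i' = 0 := fun i i' h =>
    mckayMatrix_eq_zero hS (R.comp S.rightHom)
      (fun a => (congrArg R (S.rightHom_inl_apply a)).trans (map_one R)) h
  have hF : ∀ k k', d k ≠ d k' → mckayMatrix (R.comp T.rightHom) k k' = 0 := fun k k' h =>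
    mckayMatrix_eq_zero hT' (R.comp T.rightHom)
      (fun b => (congrArg R (T.rightHom_inl_apply b)).trans (map_one R)) h
  have harrow : ∀ i i', Nonempty (Fin (mckayMatrix (R.comp S.rightHom) i i') ≃
      {_t : Fin (mckayMatrix (R.comp T.rightHom) (f i) (f i')) // (φ i).1 = (φ i').1}) := by
    intro i i'
    -- Within a block the multiplicities agree and the labels coincide. Between different blocks
    -- both sides are empty: either the labels differ, or the characters of B differ and the
    -- multiplicity over F vanishes.
    by_cases hc : c i = c i'
    · have hm : mckayMatrix (R.comp S.rightHom) i i' =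
          mckayMatrix (R.comp T.rightHom) (f i) (f i') := by
        have hi' := hu i'
        rw [← hc] at hi'
        exact mckayMatrix_eq_of_isTwist hp hq _ _
          (fun x => congrArg R (fiberProduct.rightHom_fst x)) (hu i) hi'
      have hl : (φ i).1 = (φ i').1 := by simp only [φ, hc]
      exact ⟨(finCongr hm).trans (Equiv.subtypeUnivEquiv fun _ => hl).symm⟩
    · have : IsEmpty (Fin (mckayMatrix (R.comp S.rightHom) i i')) := by
        rw [hE i i' hc]; infer_instance
      have : IsEmpty {_t : Fin (mckayMatrix (R.comp T.rightHom) (f i) (f i')) //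
          (φ i).1 = (φ i').1} := by
        refine ⟨fun t => ?_⟩
        have hd : d (f i) ≠ d (f i') := fun hd => hc (e.injective (by rw [h3, h3, t.2, hd]))
        exact (Fin.cast (hF _ _ hd) t.1).elim0
      exact ⟨Equiv.equivOfIsEmpty _ _⟩
  exact ⟨⟨Equiv.ofBijective φ ⟨hinj, hsurj⟩, fun i i' => (harrow i i').some⟩⟩
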